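/- Let $\mathbb D$ be the open unit disc and $\mathbb T$ the unit circle with normalized Lebesgue measure $m$. For $p,q\ge 0$ let $H^\infty(\mathbb T,M_{p\times q})$ be the set of (classes, modulo equality a.e., of) measurable essentially bounded functions $\Phi:\mathbb T\to M_{p\times q}(\mathbb C)$ whose Fourier coefficients $\int_{\mathbb T}\bar z^{\,l}\Phi(z)\,dm(z)$ vanish for all $l<0$; write $M_n=M_{n\times n}$. For such $\Phi$ and $\zeta\in\mathbb D$, the Poisson integral is $$P[\Phi](\zeta)=\int_{\mathbb T}\frac{1-|\zeta|^2}{|z-\zeta|^2}\,\Phi(z)\,dm(z),$$ and we put $\widetilde\Phi(z):=\Phi(\bar z)^*$. A function $\Delta\in H^\infty(\mathbb T,M_{p\times k})$ is inner if $\Delta^*\Delta=I_k$ a.e. on $\mathbb T$; an inner $\Delta$ is a left inner divisor of $\Phi\in H^\infty(\mathbb T,M_{p\times q})$ if $\Phi=\Delta A$ a.e. for some $A\in H^\infty(\mathbb T,M_{k\times q})$, and it is nontrivial if it is not a.e. equal to a constant unitary operator $\mathbb C^k\to\mathbb C^p$. Two functions $\Phi,\Psi$ in $H^\infty$ with the same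 number of rows are left coprime if they have no common nontrivial left inner divisor; two functions $\Phi,\Psi$ in $H^\infty$ with the same number of columns are right coprime if $\widetilde\Phi$ and $\widetilde\Psi$ are left coprime. A finite Blaschke product is a function $\theta(z)=\nu\prod_{j=1}^M\frac{z-\alpha_j}{1-\overline{\alpha_j}z}$ on the closed unit disc, with $|\nu|=1$, $M\ge 0$ and $\alpha_1,\dots,\alpha_M\in\mathbb D$ (not necessarily distinct); $\mathcal Z(\theta)$ denotes the set of its zeros in $\mathbb D$. **Corollary 4.6.** Let $\Phi\in H^\infty(\mathbb T,M_n)$ and $\Theta:=\theta I_n$, where $\theta$ is a finite Blaschke product. Then the following statements are equivalent: (a) $P[\Phi](\alpha)$ is invertible for each $\alpha\in\mathcal Z(\theta)$; (b) $\Phi$ and $\Theta$ are right coprime; (c) $\Phi$ and $\Theta$ are left coprime. -/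

import Mathlib

open MeasureTheory Matrix

noncomputable section

namespace HInfty

/-- The unit circle `𝕋`, parametrised by `t ↦ e^{it}` (that is, by `AddCircle.toCircle`) with
`t ∈ ℝ / 2πℤ`.  A function on `𝕋` is a function of `t`; complex conjugation of the point `e^{it}` is
`t ↦ -t`.  The normalized Lebesgue measure is `AddCircle.haarAddCircle`, and
`fourierCoeff f n = ∫ e^{-int} f(t) dm(t)`. -/
abbrev Torus : Type := AddCircle (2 * Real.pi)

instance fact_two_pi_pos : Fact (0 < 2 * Real.pi) := ⟨Real.two_pi_pos⟩

/-- The normalized Lebesgue measure `m` on `𝕋`. -/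
abbrev torusMeasure : Measure Torus := AddCircle.haarAddCircle

/-- `Φ ∈ H^∞(𝕋, M_{m×n})`: the entries of `Φ` are measurable and essentially bounded, and all Fourier
coefficients of negative index vanish.  Elements of `H^∞` are given by representatives, so every
identity between them below is an identity almost everywhere. -/
structure MemHInfty {m n : ℕ} (Φ : Torus → Matrix (Fin m) (Fin n) ℂ) : Prop where
  memLp : ∀ i j, MemLp (fun t => Φ t i j) ⊤ torusMeasure
  fourierCoeff_eq_zero : ∀ i j, ∀ l : ℤ, l < 0 → fourierCoeff (fun t => Φ t i j) l = 0

/-- The Poisson integral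
`P[Φ](ζ) = (1/2π) ∫ (1 - |ζ|²) / |e^{it} - ζ|² Φ(e^{it}) dt`, taken entrywise. -/
def poissonIntegral {m n : ℕ} (Φ : Torus → Matrix (Fin m) (Fin n) ℂ) (ζ : ℂ) :
    Matrix (Fin m) (Fin n) ℂ :=
  Matrix.of fun i j =>
    ∫ t, (poissonKernel 0 ζ (AddCircle.toCircle t : ℂ) : ℂ) * Φ t i j ∂torusMeasure

/-- An inner function with values in `M_{m×n}`: `Δ ∈ H^∞` and `Δ^* Δ = I_n` a.e. on `𝕋`. -/
structure IsInner {m n : ℕ} (Δ : Torus → Matrix (Fin m) (Fin n) ℂ) : Prop where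
  memHInfty : MemHInfty Δ
  isometry : ∀ᵐ t ∂torusMeasure, (Δ t)ᴴ * Δ t = 1

/-- `Δ` is a left inner divisor of `Φ`: `Δ` is inner and `Φ = Δ A` for some `A ∈ H^∞`. -/
def IsLeftInnerDivisor {m n k : ℕ} (Δ : Torus → Matrix (Fin m) (Fin k) ℂ)
    (Φ : Torus → Matrix (Fin m) (Fin n) ℂ) : Prop :=
  IsInner Δ ∧ ∃ A : Torus → Matrix (Fin k) (Fin n) ℂ,
    MemHInfty A ∧ ∀ᵐ t ∂torusMeasure, Φ t = Δ t * A t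

/-- `Δ` is a.e. equal to a constant unitary operator `V : ℂ^k → ℂ^m`. -/
def IsUnitaryConstant {m k : ℕ} (Δ : Torus → Matrix (Fin m) (Fin k) ℂ) : Prop :=
  ∃ V : Matrix (Fin m) (Fin k) ℂ, Vᴴ * V = 1 ∧ V * Vᴴ = 1 ∧ ∀ᵐ t ∂torusMeasure, Δ t = V

/-- `Φ` and `Ψ` are left coprime: they have no common nontrivial left inner divisor, i.e. every
common left inner divisor is a unitary constant.  (As `Δ^* Δ = I`, the space on which a left inner
divisor acts has dimension at most `m`, so it may be taken to be some `ℂ^k`.) -/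
def LeftCoprime {m n₁ n₂ : ℕ} (Φ : Torus → Matrix (Fin m) (Fin n₁) ℂ)
    (Ψ : Torus → Matrix (Fin m) (Fin n₂) ℂ) : Prop :=
  ∀ (k : ℕ) (Δ : Torus → Matrix (Fin m) (Fin k) ℂ),
    IsLeftInnerDivisor Δ Φ → IsLeftInnerDivisor Δ Ψ → IsUnitaryConstant Δ

/-- `Φ~(z) = Φ(z̄)^*`. -/
def tilde {m n : ℕ} (Φ : Torus → Matrix (Fin m) (Fin n) ℂ) : Torus → Matrix (Fin n) (Fin m) ℂ :=
  fun t => (Φ (-t))ᴴ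

/-- `Φ` and `Ψ` are right coprime: `Φ~` and `Ψ~` are left coprime. -/
def RightCoprime {m₁ m₂ n : ℕ} (Φ : Torus → Matrix (Fin m₁) (Fin n) ℂ)
    (Ψ : Torus → Matrix (Fin m₂) (Fin n) ℂ) : Prop :=
  LeftCoprime (tilde Φ) (tilde Ψ)

/-- The Blaschke factor `b_α(z) = (z - α) / (1 - ᾱ z)`. -/
def blaschkeFactor (α z : ℂ) : ℂ := (z - α) / (1 - (starRingEnd ℂ) α * z)

/-- `θ` is, on the closed unit disc, a finite Blaschke product `ν ∏ b_{α_j}` with `|ν| = 1` and all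
`α_j` in the open unit disc (repetitions allowed). -/
def IsFiniteBlaschkeProduct (θ : ℂ → ℂ) : Prop :=
  ∃ (ν : ℂ) (M : ℕ) (a : Fin M → ℂ), ‖ν‖ = 1 ∧ (∀ j, ‖a j‖ < 1) ∧
    ∀ z : ℂ, ‖z‖ ≤ 1 → θ z = ν * ∏ j, blaschkeFactor (a j) z

/-- `𝒵(θ)`, the set of zeros of `θ` in the open unit disc. -/
def zeros (θ : ℂ → ℂ) : Set ℂ := {α | ‖α‖ < 1 ∧ θ α = 0}

/-- The function `Θ = θ I_n` on `𝕋`. -/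
def scalarFunction (n : ℕ) (θ : ℂ → ℂ) : Torus → Matrix (Fin n) (Fin n) ℂ :=
  fun t => θ (AddCircle.toCircle t : ℂ) • (1 : Matrix (Fin n) (Fin n) ℂ)

end HInfty

end

/-! On `H^∞` the Poisson integral at a point `α` of the disc is evaluation at `α`: it is
multiplicative (`poissonIntegral_mul`), and a function that vanishes at `α` can be divided by `b_α`
inside `H^∞` (`MemHInfty.div_blaschkeFactor`). Everything rests on these two facts, proved from
Fourier coefficients on the circle without analytic extension.

If `Φ(α)` is singular at a zero `α` of `θ`, some nonzero orthogonal projection `Q` satisfies `Q Φ(α)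
= 0`. Then the nonconstant inner function `(1 - Q) + b_α Q` divides both `Φ` and `θI` on the left.
Conversely, let `Δ` be a common left divisor, `Φ = ΔA` and `θI = ΔB`, with every `Φ(α)` invertible.
Then `Δ` is square and `Δ(α)` is invertible at each zero, so `B` vanishes there and the Blaschke
factors cancel one at a time. What remains is `ΔC = νI`; hence `Δ^* = ν⁻¹C` also lies in `H^∞`,
which forces `Δ` to be constant.

The right coprime case is the left one for `Φ~` and `θ~I`, since `Φ~(ᾱ) = Φ(α)^*` and the zeros of
`θ~` are the conjugates of those of `θ`. -/

namespace HInfty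

open scoped ComplexConjugate

/-! ### Fourier analysis on the circle. -/

/-- The coordinate function `z` on the unit circle. -/
noncomputable def coord (t : Torus) : ℂ := AddCircle.toCircle t

lemma norm_coord (t : Torus) : ‖coord t‖ = 1 := Circle.norm_coe _

lemma coord_ne_zero (t : Torus) : coord t ≠ 0 := Circle.coe_ne_zero _

lemma continuous_coord : Continuous coord :=
  continuous_induced_dom.comp AddCircle.continuous_toCircle

lemma conj_coord (t : Torus) : conj (coord t) = (coord t)⁻¹ := by
  rw [Complex.inv_def, Complex.normSq_eq_norm_sq, norm_coord]; simp

lemma coord_neg (t : Torus) : coord (-t) = conj (coord t) := by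
  rw [conj_coord, coord, AddCircle.toCircle_neg, Circle.coe_inv, coord]

lemma fourier_eq_coord_zpow (n : ℤ) (t : Torus) : fourier n t = coord t ^ n := by
  rw [fourier_apply, AddCircle.toCircle_zsmul, Circle.coe_zpow, coord]

lemma fourierCoeff_eq_integral_coord (f : Torus → ℂ) (n : ℤ) :
    fourierCoeff f n = ∫ t, coord t ^ (-n) * f t ∂torusMeasure := by
  simp only [fourierCoeff, fourier_eq_coord_zpow, smul_eq_mul]

lemma memLp_top_of_continuous {f : Torus → ℂ} (hf : Continuous f) : MemLp f ⊤ torusMeasure := by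
  obtain ⟨C, hC⟩ := (isCompact_range hf).isBounded.exists_norm_le
  exact memLp_top_of_bound hf.aestronglyMeasurable C
    (Filter.Eventually.of_forall fun t => hC _ ⟨t, rfl⟩)

lemma memLp_top_mul {f g : Torus → ℂ} (hf : MemLp f ⊤ torusMeasure)
    (hg : MemLp g ⊤ torusMeasure) : MemLp (fun t => f t * g t) ⊤ torusMeasure :=
  hg.mul' hf

lemma memLp_top_conj {f : Torus → ℂ} (hf : MemLp f ⊤ torusMeasure) :
    MemLp (fun t => conj (f t)) ⊤ torusMeasure := hf.star

lemma integrable_of_memLp_top {f : Torus → ℂ} (hf : MemLp f ⊤ torusMeasure) :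
    Integrable f torusMeasure := hf.integrable le_top

lemma memLp_top_coord_zpow (n : ℤ) : MemLp (fun t => coord t ^ n) ⊤ torusMeasure := by
  simp only [← fourier_eq_coord_zpow]
  exact memLp_top_of_continuous (fourier n).continuous

/-- Parseval's formula for the bilinear pairing of essentially bounded functions. -/
lemma hasSum_fourierCoeff_mul {f g : Torus → ℂ} (hf : MemLp f ⊤ torusMeasure)
    (hg : MemLp g ⊤ torusMeasure) :
    HasSum (fun i : ℤ => fourierCoeff f (-i) * fourierCoeff g i)
      (∫ t, f t * g t ∂torusMeasure) := by
  -- Conjugating `f` turns the sesquilinear `L²` inner product into the bilinear pairing.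
  have hf2 : MemLp (fun t => conj (f t)) 2 torusMeasure := (memLp_top_conj hf).mono_exponent le_top
  have hg2 : MemLp g 2 torusMeasure := hg.mono_exponent le_top
  have key := (fourierBasis (T := 2 * Real.pi)).hasSum_inner_mul_inner hf2.toLp hg2.toLp
  convert! key using 1
  · ext i
    congr 1
    · rw [coe_fourierBasis, L2.inner_def, fourierCoeff_eq_integral_coord]
      refine integral_congr_ae ?_
      filter_upwards [hf2.coeFn_toLp, coeFn_fourierLp (T := 2 * Real.pi) 2 i] with t h1 h2
      rw [h1, h2, fourier_eq_coord_zpow]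
      simp [RCLike.inner_apply]
    · rw [← HilbertBasis.repr_apply_apply, fourierBasis_repr]
      exact (congrFun (fourierCoeff_congr_ae hg2.coeFn_toLp) i).symm
  · rw [L2.inner_def]
    refine integral_congr_ae ?_
    filter_upwards [hf2.coeFn_toLp, hg2.coeFn_toLp] with t h1 h2
    rw [h1, h2]
    simp [RCLike.inner_apply, mul_comm]

/-- An essentially bounded function all of whose nonconstant Fourier coefficients vanish is a.e.
constant. -/
lemma ae_eq_const_of_fourierCoeff {f : Torus → ℂ} (hf : MemLp f ⊤ torusMeasure)
    (h : ∀ n : ℤ, n ≠ 0 → fourierCoeff f n = 0) :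
    ∀ᵐ t ∂torusMeasure, f t = fourierCoeff f 0 := by
  have hf2 : MemLp f 2 torusMeasure := hf.mono_exponent le_top
  have h1 : hf2.toLp = fourierCoeff f 0 • fourierLp (T := 2 * Real.pi) 2 0 := by
    refine (hasSum_fourier_series_L2 hf2.toLp).unique ?_
    simp only [fourierCoeff_congr_ae hf2.coeFn_toLp]
    exact hasSum_single 0 fun n hn => by rw [h n hn, zero_smul]
  have h2 := Lp.coeFn_smul (fourierCoeff f 0) (fourierLp (T := 2 * Real.pi) 2 0)
  rw [← h1] at h2
  filter_upwards [hf2.coeFn_toLp, h2, coeFn_fourierLp (T := 2 * Real.pi) 2 0] with t h3 h4 h5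
  rw [← h3, h4, Pi.smul_apply, h5, fourier_zero, smul_eq_mul, mul_one]

/-! ### The algebra of scalar `H^∞` functions. -/

/-- The scalar space `H^∞` of the unit circle. -/
structure MemScalarHInfty (f : Torus → ℂ) : Prop where
  memLp : MemLp f ⊤ torusMeasure
  fourierCoeff_eq_zero : ∀ l : ℤ, l < 0 → fourierCoeff f l = 0

lemma memHInfty_iff {m n : ℕ} {Φ : Torus → Matrix (Fin m) (Fin n) ℂ} :
    MemHInfty Φ ↔ ∀ i j, MemScalarHInfty fun t => Φ t i j :=
  ⟨fun h i j => ⟨h.1 i j, h.2 i j⟩, fun h => ⟨fun i j => (h i j).1, fun i j => (h i j).2⟩⟩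

namespace MemScalarHInfty

variable {f g : Torus → ℂ}

lemma integrable (hf : MemScalarHInfty f) : Integrable f torusMeasure :=
  integrable_of_memLp_top hf.memLp

lemma congr (hf : MemScalarHInfty f) (h : ∀ᵐ t ∂torusMeasure, f t = g t) : MemScalarHInfty g :=
  ⟨hf.memLp.ae_eq h, fun l hl => by
    rw [← fourierCoeff_congr_ae h, hf.fourierCoeff_eq_zero l hl]⟩

lemma integral_coord_pow_mul (hf : MemScalarHInfty f) (k : ℕ) :
    ∫ t, coord t ^ (k + 1) * f t ∂torusMeasure = 0 := by
  have h := hf.fourierCoeff_eq_zero (-(k + 1 : ℕ)) (by omega)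
  rw [fourierCoeff_eq_integral_coord, neg_neg] at h
  simpa only [zpow_natCast] using h

lemma integral_coord_mul (hf : MemScalarHInfty f) :
    ∫ t, coord t * f t ∂torusMeasure = 0 := by
  simpa using hf.integral_coord_pow_mul 0

lemma of_integral (hf : MemLp f ⊤ torusMeasure)
    (h : ∀ k : ℕ, ∫ t, coord t ^ (k + 1) * f t ∂torusMeasure = 0) : MemScalarHInfty f := by
  refine ⟨hf, fun l hl => ?_⟩
  obtain ⟨k, rfl⟩ : ∃ k : ℕ, l = -((k + 1 : ℕ) : ℤ) := ⟨(-l - 1).toNat, by omega⟩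
  rw [fourierCoeff_eq_integral_coord, neg_neg]
  simpa only [zpow_natCast] using h k

/-- By Parseval, the moment of `fg` against `z^(k+1)` is a sum over `i` of products of the
coefficient of `g` at `i` and that of `f` at `-(i+k+1)`. One of these two indices is always
negative. -/
lemma mul (hf : MemScalarHInfty f) (hg : MemScalarHInfty g) :
    MemScalarHInfty fun t => f t * g t := by
  refine of_integral (memLp_top_mul hf.memLp hg.memLp) fun k => ?_
  have hz := memLp_top_mul (memLp_top_coord_zpow (k + 1 : ℕ)) hf.memLp
  have h := hasSum_fourierCoeff_mul hz hg.memLp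
  have h0 : (fun i : ℤ => fourierCoeff (fun t => coord t ^ ((k + 1 : ℕ) : ℤ) * f t) (-i) *
      fourierCoeff g i) = fun _ => 0 := by
    ext i
    rcases lt_or_ge i 0 with hi | hi
    · rw [hg.fourierCoeff_eq_zero i hi, mul_zero]
    · have := hf.fourierCoeff_eq_zero (-(i + (k + 1 : ℕ))) (by push_cast; omega)
      rw [fourierCoeff_eq_integral_coord] at this ⊢
      simp only [← mul_assoc, ← zpow_add₀ (coord_ne_zero _), neg_neg] at this ⊢
      rw [this, zero_mul]
  rw [h0] at h
  have := h.unique hasSum_zero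
  simpa only [zpow_natCast, mul_assoc] using this

lemma add (hf : MemScalarHInfty f) (hg : MemScalarHInfty g) :
    MemScalarHInfty fun t => f t + g t := by
  refine ⟨hf.memLp.add hg.memLp, fun l hl => ?_⟩
  have := congrFun (fourierCoeff.add hf.integrable hg.integrable) l
  rw [Pi.add_apply, hf.fourierCoeff_eq_zero l hl, hg.fourierCoeff_eq_zero l hl, add_zero] at this
  exact this

lemma const_mul (hf : MemScalarHInfty f) (c : ℂ) : MemScalarHInfty fun t => c * f t :=
  ⟨hf.memLp.const_mul c, fun l hl => by
    rw [fourierCoeff.const_mul, hf.fourierCoeff_eq_zero l hl, mul_zero]⟩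

lemma coord_pow (n : ℕ) : MemScalarHInfty fun t => coord t ^ n := by
  refine ⟨by simpa using memLp_top_coord_zpow n, fun l hl => ?_⟩
  have h := fourierCoeff_fourier (T := 2 * Real.pi) n
  have h2 : (fun t : Torus => coord t ^ n) = fourier (T := 2 * Real.pi) n := by
    ext t; rw [fourier_eq_coord_zpow, zpow_natCast]
  rw [h2, h, Pi.single_apply, if_neg (by omega)]

lemma const (c : ℂ) : MemScalarHInfty fun _ => c := by
  simpa using (coord_pow 0).const_mul c

lemma coord : MemScalarHInfty coord := by
  simpa using coord_pow 1

lemma sub (hf : MemScalarHInfty f) (hg : MemScalarHInfty g) :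
    MemScalarHInfty fun t => f t - g t := by
  simpa [sub_eq_add_neg] using hf.add (hg.const_mul (-1))

lemma sum {ι : Type*} {s : Finset ι} {f : ι → Torus → ℂ} (h : ∀ i ∈ s, MemScalarHInfty (f i)) :
    MemScalarHInfty fun t => ∑ i ∈ s, f i t := by
  classical
  induction s using Finset.induction_on with
  | empty => simpa using const 0
  | insert a s ha ih =>
    simp only [Finset.sum_insert ha]
    exact (h a (by simp)).add (ih fun i hi => h i (by simp [hi]))

lemma prod {ι : Type*} {s : Finset ι} {f : ι → Torus → ℂ} (h : ∀ i ∈ s, MemScalarHInfty (f i)) :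
    MemScalarHInfty fun t => ∏ i ∈ s, f i t := by
  classical
  induction s using Finset.induction_on with
  | empty => simpa using const 1
  | insert a s ha ih =>
    simp only [Finset.prod_insert ha]
    exact (h a (by simp)).mul (ih fun i hi => h i (by simp [hi]))

/-- Reflection and conjugation each reverse the Fourier index, so together they only conjugate the
coefficients. -/
lemma conj_neg (hf : MemScalarHInfty f) : MemScalarHInfty fun t => conj (f (-t)) := by
  have hmp : MeasurePreserving (fun t : Torus => -t) torusMeasure torusMeasure :=
    Measure.measurePreserving_neg _
  refine of_integral (memLp_top_conj (hf.memLp.comp_measurePreserving hmp)) fun k => ?_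
  have h := hf.integral_coord_pow_mul k
  rw [← integral_neg_eq_self] at h
  have h2 := congrArg conj h
  rw [← integral_conj, map_zero] at h2
  simpa [coord_neg] using h2

/-- A function that lies in `H^∞` together with its conjugate is a.e. constant. -/
lemma ae_eq_const_of_conj (hf : MemScalarHInfty f) (hc : MemScalarHInfty fun t => conj (f t)) :
    ∃ c, ∀ᵐ t ∂torusMeasure, f t = c := by
  refine ⟨_, ae_eq_const_of_fourierCoeff hf.memLp fun n hn => ?_⟩
  rcases lt_or_gt_of_ne hn with h | h
  · exact hf.fourierCoeff_eq_zero n h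
  · have := congrArg conj (hc.fourierCoeff_eq_zero (-n) (by omega))
    rw [fourierCoeff_eq_integral_coord, ← integral_conj, map_zero] at this
    rw [fourierCoeff_eq_integral_coord, ← this]
    simp [conj_coord]

end MemScalarHInfty

/-! ### Blaschke factors and evaluation at a point of the disc. -/

section Disc

variable {α : ℂ}

lemma one_sub_conj_mul_ne_zero (hα : ‖α‖ < 1) {z : ℂ} (hz : ‖z‖ ≤ 1) : 1 - conj α * z ≠ 0 := by
  intro h
  have h1 : ‖conj α * z‖ = 1 := by rw [← sub_eq_zero.mp h, norm_one]
  rw [norm_mul, RCLike.norm_conj] at h1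
  nlinarith [norm_nonneg α, norm_nonneg z]

lemma one_sub_conj_mul_coord_ne_zero (hα : ‖α‖ < 1) (t : Torus) : 1 - conj α * coord t ≠ 0 :=
  one_sub_conj_mul_ne_zero hα (norm_coord t).le

lemma coord_sub_ne_zero (hα : ‖α‖ < 1) (t : Torus) : coord t - α ≠ 0 := by
  intro h
  rw [← sub_eq_zero.mp h, norm_coord] at hα
  exact lt_irrefl _ hα

lemma blaschkeFactor_coord_ne_zero (hα : ‖α‖ < 1) (t : Torus) :
    blaschkeFactor α (coord t) ≠ 0 :=
  div_ne_zero (coord_sub_ne_zero hα t) (one_sub_conj_mul_coord_ne_zero hα t)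

lemma conj_one_sub_conj_mul_coord (α : ℂ) (t : Torus) :
    conj (1 - conj α * coord t) = (coord t - α) * (coord t)⁻¹ := by
  have := coord_ne_zero t
  simp only [map_sub, map_one, map_mul, Complex.conj_conj, conj_coord]
  field_simp

lemma conj_blaschkeFactor_mul_self (hα : ‖α‖ < 1) (t : Torus) :
    conj (blaschkeFactor α (coord t)) * blaschkeFactor α (coord t) = 1 := by
  have h1 := coord_sub_ne_zero hα t
  have h2 := one_sub_conj_mul_coord_ne_zero hα t
  have h3 := coord_ne_zero t
  have h4 : conj (coord t - α) = (1 - conj α * coord t) * (coord t)⁻¹ := by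
    simp only [map_sub, conj_coord]
    field_simp
  rw [blaschkeFactor, map_div₀, conj_one_sub_conj_mul_coord, h4]
  field_simp

/-- The values on the circle of the Cauchy kernel `1 / (1 - ᾱ z)`. -/
noncomputable def cauchyKernel (α : ℂ) (t : Torus) : ℂ := (1 - conj α * coord t)⁻¹

lemma continuous_cauchyKernel (hα : ‖α‖ < 1) : Continuous (cauchyKernel α) :=
  (continuous_const.sub (continuous_const.mul continuous_coord)).inv₀
    (one_sub_conj_mul_coord_ne_zero hα)

lemma cauchyKernel_eq (hα : ‖α‖ < 1) (t : Torus) :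
    cauchyKernel α t = 1 + conj α * (coord t * cauchyKernel α t) := by
  have := one_sub_conj_mul_coord_ne_zero hα t
  rw [cauchyKernel]
  field_simp
  ring

/-- The identity `C = 1 + ᾱ z C` gives `c k = ᾱ c (k+1)` for the moments `c k` of `C` against
`z^(k+1)`. Iterating, `|c k| ≤ |α|^j ‖C‖₁` for every `j`, so `c k = 0`. -/
lemma memScalarHInfty_cauchyKernel (hα : ‖α‖ < 1) : MemScalarHInfty (cauchyKernel α) := by
  have hm := memLp_top_of_continuous (continuous_cauchyKernel hα)
  have hi (k : ℕ) : Integrable (fun t => coord t ^ k * cauchyKernel α t) torusMeasure :=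
    integrable_of_memLp_top (memLp_top_mul (MemScalarHInfty.coord_pow k).memLp hm)
  refine MemScalarHInfty.of_integral hm fun k => ?_
  set c : ℕ → ℂ := fun k => ∫ t, coord t ^ (k + 1) * cauchyKernel α t ∂torusMeasure with hc
  have hrec (k : ℕ) : c k = conj α * c (k + 1) := by
    have h0 := (MemScalarHInfty.const 1).integral_coord_pow_mul k
    have h1 : c k = ∫ t, (coord t ^ (k + 1) * 1 +
        conj α * (coord t ^ (k + 1 + 1) * cauchyKernel α t)) ∂torusMeasure := by
      refine integral_congr_ae (Filter.Eventually.of_forall fun t => ?_)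
      simp only
      conv_lhs => rw [cauchyKernel_eq hα]
      ring
    have h2 : Integrable (fun t => coord t ^ (k + 1) * (1 : ℂ)) torusMeasure := by
      simpa using (MemScalarHInfty.coord_pow (k + 1)).integrable
    rw [h1, integral_add h2 ((hi _).const_mul _), h0, zero_add, integral_const_mul]
  have hpow (j : ℕ) : c k = conj α ^ j * c (k + j) := by
    induction j with
    | zero => simp
    | succ j ih => rw [ih, hrec (k + j)]; ring_nf
  have hbd (j : ℕ) : ‖c j‖ ≤ ∫ t, ‖cauchyKernel α t‖ ∂torusMeasure := by
    refine (norm_integral_le_integral_norm _).trans (le_of_eq ?_)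
    simp [norm_coord]
  have hlim : Filter.Tendsto (fun j : ℕ => ‖α‖ ^ j * ∫ t, ‖cauchyKernel α t‖ ∂torusMeasure)
      Filter.atTop (nhds 0) := by
    simpa using (tendsto_pow_atTop_nhds_zero_of_lt_one (norm_nonneg α) hα).mul_const
      (∫ t, ‖cauchyKernel α t‖ ∂torusMeasure)
  have hle : ‖c k‖ ≤ 0 := ge_of_tendsto' hlim fun j => by
    rw [hpow j, norm_mul, norm_pow, RCLike.norm_conj]
    exact mul_le_mul_of_nonneg_left (hbd _) (by positivity)
  exact norm_le_zero_iff.mp hle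

lemma memScalarHInfty_blaschkeFactor (hα : ‖α‖ < 1) :
    MemScalarHInfty fun t => blaschkeFactor α (coord t) :=
  (MemScalarHInfty.coord.sub (MemScalarHInfty.const α)).mul (memScalarHInfty_cauchyKernel hα)

/-- The scalar Poisson integral. -/
noncomputable def scalarPoisson (α : ℂ) (f : Torus → ℂ) : ℂ :=
  ∫ t, (poissonKernel 0 α (AddCircle.toCircle t : ℂ) : ℂ) * f t ∂torusMeasure

lemma poissonIntegral_apply {m n : ℕ} (Φ : Torus → Matrix (Fin m) (Fin n) ℂ) (α : ℂ) (i : Fin m)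
    (j : Fin n) : poissonIntegral Φ α i j = scalarPoisson α fun t => Φ t i j := rfl

/-- On the circle `z̄ = 1/z`, so `|z - α|² = (z - α)(1 - ᾱz)/z`. In this rational form the simple
pole at `α` is visible and can be cancelled against zeros of the integrand. -/
lemma poissonKernel_coord (hα : ‖α‖ < 1) (t : Torus) :
    (poissonKernel 0 α (AddCircle.toCircle t : ℂ) : ℂ) =
      (1 - conj α * α) * coord t * cauchyKernel α t / (coord t - α) := by
  have h1 := coord_sub_ne_zero hα t
  have h2 := one_sub_conj_mul_coord_ne_zero hα t
  have h3 := coord_ne_zero t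
  change (poissonKernel 0 α (coord t) : ℂ) = _
  rw [poissonKernel_def, sub_zero, sub_zero, norm_coord]
  push_cast
  rw [← Complex.conj_mul', ← Complex.conj_mul', cauchyKernel]
  have h4 : conj (coord t - α) = (1 - conj α * coord t) * (coord t)⁻¹ := by
    simp only [map_sub, conj_coord]
    field_simp
  rw [h4]
  field_simp

lemma memLp_top_poissonKernel (hα : ‖α‖ < 1) :
    MemLp (fun t : Torus => (poissonKernel 0 α (AddCircle.toCircle t : ℂ) : ℂ)) ⊤
      torusMeasure := by
  simp only [poissonKernel_coord hα]
  exact memLp_top_of_continuous (((continuous_const.mul continuous_coord).mul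
    (continuous_cauchyKernel hα)).div (continuous_coord.sub continuous_const)
    (coord_sub_ne_zero hα))

variable {f g : Torus → ℂ}

lemma integrable_poissonKernel_mul (hα : ‖α‖ < 1) (hf : MemScalarHInfty f) :
    Integrable (fun t : Torus => (poissonKernel 0 α (AddCircle.toCircle t : ℂ) : ℂ) * f t)
      torusMeasure :=
  integrable_of_memLp_top (memLp_top_mul (memLp_top_poissonKernel hα) hf.memLp)

lemma scalarPoisson_congr (h : ∀ᵐ t ∂torusMeasure, f t = g t) :
    scalarPoisson α f = scalarPoisson α g :=
  integral_congr_ae (h.mono fun t ht => by simp only [ht])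

lemma scalarPoisson_add (hα : ‖α‖ < 1) (hf : MemScalarHInfty f) (hg : MemScalarHInfty g) :
    scalarPoisson α (fun t => f t + g t) = scalarPoisson α f + scalarPoisson α g := by
  simp only [scalarPoisson, mul_add]
  exact integral_add (integrable_poissonKernel_mul hα hf) (integrable_poissonKernel_mul hα hg)

lemma scalarPoisson_const_mul (c : ℂ) (f : Torus → ℂ) :
    scalarPoisson α (fun t => c * f t) = c * scalarPoisson α f := by
  simp only [scalarPoisson, mul_left_comm _ c]
  exact integral_const_mul c _

lemma scalarPoisson_sum (hα : ‖α‖ < 1) {ι : Type*} {s : Finset ι} {f : ι → Torus → ℂ}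
    (h : ∀ i ∈ s, MemScalarHInfty (f i)) :
    scalarPoisson α (fun t => ∑ i ∈ s, f i t) = ∑ i ∈ s, scalarPoisson α (f i) := by
  simp only [scalarPoisson, Finset.mul_sum]
  exact integral_finsetSum s fun i hi => integrable_poissonKernel_mul hα (h i hi)

/-- The kernel equals `1 + ᾱzC + α·conj (zC)`, with `C` the Cauchy kernel, and `zC` has mean zero.
-/
lemma scalarPoisson_one (hα : ‖α‖ < 1) : scalarPoisson α (fun _ => 1) = 1 := by
  have hC := memScalarHInfty_cauchyKernel hα
  have hzC := MemScalarHInfty.coord.mul hC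
  have h0 : ∫ t, conj (coord t * cauchyKernel α t) ∂torusMeasure = 0 := by
    rw [integral_conj, hC.integral_coord_mul, map_zero]
  have hi : Integrable (fun t => conj (coord t * cauchyKernel α t)) torusMeasure :=
    integrable_of_memLp_top (memLp_top_conj hzC.memLp)
  have key (t : Torus) : (poissonKernel 0 α (AddCircle.toCircle t : ℂ) : ℂ) * 1 =
      (1 + conj α * (coord t * cauchyKernel α t)) + α * conj (coord t * cauchyKernel α t) := by
    have h1 := coord_sub_ne_zero hα t
    have h2 := one_sub_conj_mul_coord_ne_zero hα t
    have h3 := coord_ne_zero t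
    rw [poissonKernel_coord hα, map_mul, cauchyKernel, map_inv₀, conj_one_sub_conj_mul_coord,
      conj_coord]
    field_simp
    ring
  simp only [scalarPoisson, key]
  rw [integral_add ((MemScalarHInfty.const 1).add (hzC.const_mul _)).integrable (hi.const_mul _),
    integral_add (integrable_const _) (hzC.integrable.const_mul _), integral_const_mul,
    integral_const_mul, h0, hC.integral_coord_mul]
  simp

lemma scalarPoisson_const (hα : ‖α‖ < 1) (c : ℂ) : scalarPoisson α (fun _ => c) = c := by
  have := scalarPoisson_const_mul (α := α) c fun _ => 1
  rwa [scalarPoisson_one hα, mul_one] at this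

/-- The factor `z - α` cancels the pole of the kernel, leaving the mean of `z` times an `H^∞`
function. -/
lemma scalarPoisson_coord_sub_mul (hα : ‖α‖ < 1) (hf : MemScalarHInfty f) :
    scalarPoisson α (fun t => (coord t - α) * f t) = 0 := by
  have key (t : Torus) : (poissonKernel 0 α (AddCircle.toCircle t : ℂ) : ℂ) *
      ((coord t - α) * f t) = (1 - conj α * α) * (coord t * (cauchyKernel α t * f t)) := by
    have h1 := coord_sub_ne_zero hα t
    rw [poissonKernel_coord hα]
    field_simp
  simp only [scalarPoisson, key]
  rw [integral_const_mul, ((memScalarHInfty_cauchyKernel hα).mul hf).integral_coord_mul, mul_zero]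

lemma scalarPoisson_blaschkeFactor_mul (hα : ‖α‖ < 1) (hf : MemScalarHInfty f) :
    scalarPoisson α (fun t => blaschkeFactor α (coord t) * f t) = 0 := by
  have h := scalarPoisson_coord_sub_mul hα ((memScalarHInfty_cauchyKernel hα).mul hf)
  simpa only [blaschkeFactor, div_eq_mul_inv, mul_assoc, cauchyKernel] using h

lemma scalarPoisson_coord_mul (hα : ‖α‖ < 1) (hf : MemScalarHInfty f) :
    scalarPoisson α (fun t => coord t * f t) = α * scalarPoisson α f := by
  have h := scalarPoisson_add hα
    ((MemScalarHInfty.coord.sub (MemScalarHInfty.const α)).mul hf) (hf.const_mul α)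
  rw [scalarPoisson_coord_sub_mul hα hf, zero_add, scalarPoisson_const_mul] at h
  rw [← h]
  congr 1
  ext t
  ring

lemma scalarPoisson_coord_pow_mul (hα : ‖α‖ < 1) (hf : MemScalarHInfty f) (k : ℕ) :
    scalarPoisson α (fun t => coord t ^ k * f t) = α ^ k * scalarPoisson α f := by
  induction k with
  | zero => simp
  | succ k ih =>
    have := scalarPoisson_coord_mul hα ((MemScalarHInfty.coord_pow k).mul hf)
    simp only [← mul_assoc, ← pow_succ'] at this
    rw [this, ih]
    ring

/-- A function in `H^∞` that vanishes at `α` is divisible by the Blaschke factor at `α`. -/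
lemma MemScalarHInfty.div_blaschkeFactor (hα : ‖α‖ < 1) (hf : MemScalarHInfty f)
    (h0 : scalarPoisson α f = 0) :
    MemScalarHInfty fun t => (blaschkeFactor α (HInfty.coord t))⁻¹ * f t := by
  -- Multiplication by `1 - ᾱz` preserves vanishing at `α`. It is applied twice, because `(1 - |α|²)
  -- z^(k+1) b_α⁻¹ f` is the Poisson kernel times `z^k (1 - ᾱz)² f`.
  have hL {g : Torus → ℂ} (hg : MemScalarHInfty g) (hg0 : scalarPoisson α g = 0) :
      scalarPoisson α (fun t => g t + -conj α * (HInfty.coord t * g t)) = 0 := by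
    rw [scalarPoisson_add hα hg ((MemScalarHInfty.coord.mul hg).const_mul _),
      scalarPoisson_const_mul, scalarPoisson_coord_mul hα hg, hg0]
    ring
  have hLm {g : Torus → ℂ} (hg : MemScalarHInfty g) :
      MemScalarHInfty (fun t => g t + -conj α * (HInfty.coord t * g t)) :=
    hg.add ((MemScalarHInfty.coord.mul hg).const_mul _)
  have hne : 1 - conj α * α ≠ 0 := one_sub_conj_mul_ne_zero hα hα.le
  refine of_integral (memLp_top_mul (memLp_top_of_continuous ?_) hf.memLp) fun k => ?_
  · simp only [blaschkeFactor, inv_div]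
    exact (continuous_const.sub (continuous_const.mul continuous_coord)).div
      (continuous_coord.sub continuous_const) (coord_sub_ne_zero hα)
  · have h1 := scalarPoisson_coord_pow_mul hα (hLm (hLm hf)) k
    rw [hL (hLm hf) (hL hf h0), mul_zero] at h1
    rw [← mul_right_inj' hne, mul_zero, ← integral_const_mul, ← h1, scalarPoisson]
    refine integral_congr_ae (Filter.Eventually.of_forall fun t => ?_)
    have h1 := coord_sub_ne_zero hα t
    have h2 := one_sub_conj_mul_coord_ne_zero hα t
    simp only [blaschkeFactor, poissonKernel_coord hα, cauchyKernel]
    field_simp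
    ring

/-- The Poisson integral is multiplicative on `H^∞`. -/
lemma scalarPoisson_mul (hα : ‖α‖ < 1) (hf : MemScalarHInfty f) (hg : MemScalarHInfty g) :
    scalarPoisson α (fun t => f t * g t) = scalarPoisson α f * scalarPoisson α g := by
  -- Writing `f = c + b_α q` with `q` in `H^∞`, the product is `fg = cg + b_α q g`, whose last term
  -- vanishes at `α`.
  set c := scalarPoisson α f with hc
  have h1 : MemScalarHInfty fun t => f t + -c := hf.add (MemScalarHInfty.const _)
  have h2 : scalarPoisson α (fun t => f t + -c) = 0 := by
    rw [scalarPoisson_add hα hf (MemScalarHInfty.const _), scalarPoisson_const hα, ← hc]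
    ring
  have hq := (h1.div_blaschkeFactor hα h2).mul hg
  have h3 : (fun t => f t * g t) = fun t => c * g t + blaschkeFactor α (coord t) *
      ((blaschkeFactor α (coord t))⁻¹ * (f t + -c) * g t) := by
    ext t
    have := blaschkeFactor_coord_ne_zero hα t
    field_simp
    ring
  rw [h3, scalarPoisson_add hα (hg.const_mul c) ((memScalarHInfty_blaschkeFactor hα).mul hq),
    scalarPoisson_const_mul, scalarPoisson_blaschkeFactor_mul hα hq, add_zero]

lemma scalarPoisson_conj_neg (hα : ‖α‖ < 1) (f : Torus → ℂ) :
    scalarPoisson (conj α) (fun t => conj (f (-t))) = conj (scalarPoisson α f) := by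
  have hα' : ‖conj α‖ < 1 := by rwa [RCLike.norm_conj]
  rw [scalarPoisson, scalarPoisson, ← integral_conj, ← integral_neg_eq_self]
  refine integral_congr_ae (Filter.Eventually.of_forall fun t => ?_)
  simp only [poissonKernel_coord hα', poissonKernel_coord hα, neg_neg, cauchyKernel, coord_neg]
  simp

end Disc

/-! ### Evaluation of matrix-valued functions and cancellation of zeros. -/

variable {m n k : ℕ} {α : ℂ}

lemma MemHInfty.apply {Φ : Torus → Matrix (Fin m) (Fin n) ℂ} (h : MemHInfty Φ) (i : Fin m)
    (j : Fin n) : MemScalarHInfty fun t => Φ t i j := memHInfty_iff.mp h i j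

lemma MemHInfty.mul {Φ : Torus → Matrix (Fin m) (Fin n) ℂ} {Ψ : Torus → Matrix (Fin n) (Fin k) ℂ}
    (hΦ : MemHInfty Φ) (hΨ : MemHInfty Ψ) : MemHInfty fun t => Φ t * Ψ t :=
  memHInfty_iff.mpr fun i j => by
    simp only [Matrix.mul_apply]
    exact MemScalarHInfty.sum fun l _ => (hΦ.apply i l).mul (hΨ.apply l j)

lemma MemHInfty.add {Φ Ψ : Torus → Matrix (Fin m) (Fin n) ℂ}
    (hΦ : MemHInfty Φ) (hΨ : MemHInfty Ψ) : MemHInfty fun t => Φ t + Ψ t :=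
  memHInfty_iff.mpr fun i j => (hΦ.apply i j).add (hΨ.apply i j)

lemma MemHInfty.const (A : Matrix (Fin m) (Fin n) ℂ) : MemHInfty fun _ => A :=
  memHInfty_iff.mpr fun i j => MemScalarHInfty.const (A i j)

lemma MemHInfty.smul {f : Torus → ℂ} {Φ : Torus → Matrix (Fin m) (Fin n) ℂ}
    (hf : MemScalarHInfty f) (hΦ : MemHInfty Φ) : MemHInfty fun t => f t • Φ t :=
  memHInfty_iff.mpr fun i j => hf.mul (hΦ.apply i j)

lemma MemHInfty.tilde {Φ : Torus → Matrix (Fin m) (Fin n) ℂ} (hΦ : MemHInfty Φ) :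
    MemHInfty (tilde Φ) :=
  memHInfty_iff.mpr fun i j => (hΦ.apply j i).conj_neg

lemma poissonIntegral_congr {Φ Ψ : Torus → Matrix (Fin m) (Fin n) ℂ}
    (h : ∀ᵐ t ∂torusMeasure, Φ t = Ψ t) : poissonIntegral Φ α = poissonIntegral Ψ α := by
  ext i j
  exact scalarPoisson_congr (h.mono fun t ht => by simp only [ht])

lemma poissonIntegral_const (hα : ‖α‖ < 1) (A : Matrix (Fin m) (Fin n) ℂ) :
    poissonIntegral (fun _ => A) α = A := by
  ext i j
  exact scalarPoisson_const hα _

/-- The Poisson integral is multiplicative on matrix-valued `H^∞`. -/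
lemma poissonIntegral_mul (hα : ‖α‖ < 1) {Φ : Torus → Matrix (Fin m) (Fin n) ℂ}
    {Ψ : Torus → Matrix (Fin n) (Fin k) ℂ} (hΦ : MemHInfty Φ) (hΨ : MemHInfty Ψ) :
    poissonIntegral (fun t => Φ t * Ψ t) α = poissonIntegral Φ α * poissonIntegral Ψ α := by
  ext i j
  simp only [Matrix.mul_apply, poissonIntegral_apply]
  rw [scalarPoisson_sum hα fun l _ => (hΦ.apply i l).mul (hΨ.apply l j)]
  exact Finset.sum_congr rfl fun l _ => scalarPoisson_mul hα (hΦ.apply i l) (hΨ.apply l j)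

lemma poissonIntegral_blaschkeFactor_smul (hα : ‖α‖ < 1) {Φ : Torus → Matrix (Fin m) (Fin n) ℂ}
    (hΦ : MemHInfty Φ) :
    poissonIntegral (fun t => blaschkeFactor α (coord t) • Φ t) α = 0 := by
  ext i j
  exact scalarPoisson_blaschkeFactor_mul hα (hΦ.apply i j)

lemma MemHInfty.div_blaschkeFactor (hα : ‖α‖ < 1) {Φ : Torus → Matrix (Fin m) (Fin n) ℂ}
    (hΦ : MemHInfty Φ) (h0 : poissonIntegral Φ α = 0) :
    MemHInfty fun t => (blaschkeFactor α (coord t))⁻¹ • Φ t :=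
  memHInfty_iff.mpr fun i j =>
    (hΦ.apply i j).div_blaschkeFactor hα (by rw [← poissonIntegral_apply, h0, Matrix.zero_apply])

lemma poissonIntegral_tilde (hα : ‖α‖ < 1) (Φ : Torus → Matrix (Fin m) (Fin n) ℂ) :
    poissonIntegral (tilde Φ) (conj α) = (poissonIntegral Φ α)ᴴ := by
  ext i j
  exact scalarPoisson_conj_neg hα fun t => Φ t j i

/-- Zeros of a finite Blaschke product at which a left factor is invertible can be cancelled. -/
lemma exists_mul_eq_of_mul_eq_blaschke {Δ : Torus → Matrix (Fin n) (Fin n) ℂ} (hΔ : MemHInfty Δ)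
    (ν : ℂ) {M : ℕ} (a : Fin M → ℂ) (ha : ∀ j, ‖a j‖ < 1)
    (hu : ∀ j, IsUnit (poissonIntegral Δ (a j))) (B : Torus → Matrix (Fin n) (Fin n) ℂ)
    (hB : MemHInfty B)
    (h : ∀ᵐ t ∂torusMeasure, Δ t * B t =
      (ν * ∏ j, blaschkeFactor (a j) (coord t)) • (1 : Matrix (Fin n) (Fin n) ℂ)) :
    ∃ C : Torus → Matrix (Fin n) (Fin n) ℂ, MemHInfty C ∧
      ∀ᵐ t ∂torusMeasure, Δ t * C t = ν • (1 : Matrix (Fin n) (Fin n) ℂ) := by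
  induction M generalizing B with
  | zero => exact ⟨B, hB, by simpa using h⟩
  | succ M ih =>
    have hprod : MemScalarHInfty fun t => ν * ∏ j : Fin M, blaschkeFactor (a j.succ) (coord t) :=
      (MemScalarHInfty.prod fun j _ => memScalarHInfty_blaschkeFactor (ha j.succ)).const_mul ν
    -- The right-hand side contains `b_(a 0)`, so it vanishes at `a 0`. Since `Δ(a 0)` is
    -- invertible, `B` itself vanishes there and absorbs the division.
    have h0 : poissonIntegral Δ (a 0) * poissonIntegral B (a 0) = 0 := by
      rw [← poissonIntegral_mul (ha 0) hΔ hB, poissonIntegral_congr h,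
        ← poissonIntegral_blaschkeFactor_smul (ha 0)
          (MemHInfty.smul hprod (MemHInfty.const (1 : Matrix (Fin n) (Fin n) ℂ)))]
      congr 1
      ext t : 1
      rw [Fin.prod_univ_succ, smul_smul, mul_left_comm]
    refine ih (fun j => a j.succ) (fun j => ha _) (fun j => hu _)
      (fun t => (blaschkeFactor (a 0) (coord t))⁻¹ • B t)
      (hB.div_blaschkeFactor (ha 0) ((hu 0).mul_right_eq_zero.mp h0)) ?_
    filter_upwards [h] with t ht
    have := blaschkeFactor_coord_ne_zero (ha 0) t
    rw [Matrix.mul_smul, ht, smul_smul, Fin.prod_univ_succ]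
    congr 1
    field_simp

/-- `D^*` is a left inverse and `c⁻¹B` a right inverse, so they agree and `D` is unitary; comparing
traces gives the dimensions. This rules out non-square divisors of `θI`. -/
lemma eq_of_isometry_of_mul_eq_smul_one {D : Matrix (Fin m) (Fin k) ℂ}
    {B : Matrix (Fin k) (Fin m) ℂ} {c : ℂ} (hc : c ≠ 0) (hD : Dᴴ * D = 1) (h : D * B = c • 1) :
    k = m := by
  have h1 : D * (c⁻¹ • B) = 1 := by
    rw [Matrix.mul_smul, h, smul_smul, inv_mul_cancel₀ hc, one_smul]
  have h2 : Dᴴ = c⁻¹ • B := by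
    rw [← Matrix.mul_one Dᴴ, ← h1, ← Matrix.mul_assoc, hD, Matrix.one_mul]
  have h3 : D * Dᴴ = 1 := by rw [h2, h1]
  have h4 := Matrix.trace_mul_comm D Dᴴ
  rw [h3, hD, Matrix.trace_one, Matrix.trace_one, Fintype.card_fin, Fintype.card_fin] at h4
  exact_mod_cast h4.symm

/-- A square inner function whose adjoint also lies in `H^∞` is a unitary constant. -/
lemma isUnitaryConstant_of_mul_eq_const {Δ C : Torus → Matrix (Fin n) (Fin n) ℂ} (hΔ : IsInner Δ)
    (hC : MemHInfty C) {ν : ℂ} (hν : ‖ν‖ = 1)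
    (h : ∀ᵐ t ∂torusMeasure, Δ t * C t = ν • (1 : Matrix (Fin n) (Fin n) ℂ)) :
    IsUnitaryConstant Δ := by
  have hν0 : ν ≠ 0 := fun h0 => by simp [h0] at hν
  have hconj : ∀ᵐ t ∂torusMeasure, ν⁻¹ • C t = (Δ t)ᴴ := by
    filter_upwards [h, hΔ.isometry] with t h1 h2
    rw [← Matrix.mul_one (Δ t)ᴴ, ← one_smul ℂ (1 : Matrix (Fin n) (Fin n) ℂ),
      ← inv_mul_cancel₀ hν0, ← smul_smul, ← h1, Matrix.mul_smul, ← Matrix.mul_assoc, h2,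
      Matrix.one_mul]
  have hex (i j : Fin n) : ∃ c, ∀ᵐ t ∂torusMeasure, Δ t i j = c := by
    refine (hΔ.memHInfty.apply i j).ae_eq_const_of_conj
      (((hC.apply j i).const_mul ν⁻¹).congr ?_)
    filter_upwards [hconj] with t ht
    exact congrFun (congrFun ht j) i
  choose V hV using hex
  have hV' : ∀ᵐ t ∂torusMeasure, Δ t = Matrix.of V := by
    have := ae_all_iff.mpr fun i => ae_all_iff.mpr fun j => hV i j
    filter_upwards [this] with t ht
    ext i j
    exact ht i j
  obtain ⟨t, h1, h2⟩ := (hV'.and hΔ.isometry).exists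
  rw [h1] at h2
  exact ⟨Matrix.of V, h2, mul_eq_one_comm.mp h2, hV'⟩

/-! ### Blaschke–Potapov factors. -/

open scoped ComplexOrder in
/-- A singular square matrix is annihilated on the left by a nonzero orthogonal projection. -/
lemma exists_projection_mul_eq_zero {A : Matrix (Fin n) (Fin n) ℂ} (hA : ¬ IsUnit A) :
    ∃ Q : Matrix (Fin n) (Fin n) ℂ, Qᴴ = Q ∧ Q * Q = Q ∧ Q ≠ 0 ∧ Q * A = 0 := by
  rw [Matrix.isUnit_iff_isUnit_det, isUnit_iff_ne_zero, not_not] at hA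
  obtain ⟨w, hw, hwA⟩ := Matrix.exists_vecMul_eq_zero_iff.mpr hA
  -- `Q` is the orthogonal projection onto the line spanned by `star w`, with `w` a left null vector
  -- of `A`; `c` is the squared norm of `w`.
  set c : ℂ := w ⬝ᵥ star w with hc
  have hc0 : c ≠ 0 := fun h => hw (dotProduct_self_star_eq_zero.mp h)
  have hcs : star c = c := by rw [hc, ← star_dotProduct_star, star_star, dotProduct_comm]
  refine ⟨c⁻¹ • vecMulVec (star w) w, ?_, ?_, ?_, ?_⟩
  · rw [Matrix.conjTranspose_smul, Matrix.conjTranspose_vecMulVec, star_star, star_inv₀, hcs]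
  · rw [Matrix.smul_mul, Matrix.mul_smul, Matrix.vecMulVec_mul_vecMulVec, ← hc,
      Matrix.vecMulVec_smul, smul_smul c⁻¹ c, inv_mul_cancel₀ hc0, one_smul]
  · refine smul_ne_zero (inv_ne_zero hc0) ?_
    rw [Ne, Matrix.vecMulVec_eq_zero]
    simpa using hw
  · rw [Matrix.smul_mul, Matrix.vecMulVec_mul, hwA, Matrix.vecMulVec_zero, smul_zero]

/-- The Blaschke–Potapov factor `(1 - Q) + b_α Q`. -/
noncomputable def potapovFactor (α : ℂ) (Q : Matrix (Fin n) (Fin n) ℂ) (t : Torus) :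
    Matrix (Fin n) (Fin n) ℂ := (1 - Q) + blaschkeFactor α (coord t) • Q

lemma isInner_potapovFactor (hα : ‖α‖ < 1) {Q : Matrix (Fin n) (Fin n) ℂ} (hQ : Qᴴ = Q)
    (hQQ : Q * Q = Q) : IsInner (potapovFactor α Q) := by
  refine ⟨(MemHInfty.const _).add
    (MemHInfty.smul (memScalarHInfty_blaschkeFactor hα) (MemHInfty.const Q)),
    Filter.Eventually.of_forall fun t => ?_⟩
  have h1 : (1 - Q) * Q = 0 := by rw [Matrix.sub_mul, hQQ, Matrix.one_mul, sub_self]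
  have h2 : Q * (1 - Q) = 0 := by rw [Matrix.mul_sub, hQQ, Matrix.mul_one, sub_self]
  have h3 : (1 - Q) * (1 - Q) = 1 - Q := by
    rw [Matrix.mul_sub, h1, Matrix.mul_one, sub_zero]
  have h4 := conj_blaschkeFactor_mul_self hα t
  simp only [potapovFactor, Matrix.conjTranspose_add, Matrix.conjTranspose_sub,
    Matrix.conjTranspose_one, Matrix.conjTranspose_smul, hQ, Matrix.add_mul, Matrix.mul_add,
    Matrix.smul_mul, Matrix.mul_smul, h1, h2, h3, hQQ, smul_zero]
  rw [← starRingEnd_apply, zero_add, add_zero, smul_smul, mul_comm, h4, one_smul, sub_add_cancel]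

/-- Were the factor constant, `b_α Q` would be too. Evaluation at `α` would make that constant zero,
but `b_α` has no zero on the circle. -/
lemma not_isUnitaryConstant_potapovFactor (hα : ‖α‖ < 1) {Q : Matrix (Fin n) (Fin n) ℂ}
    (hQQ : Q * Q = Q) (hQ0 : Q ≠ 0) : ¬ IsUnitaryConstant (potapovFactor α Q) := by
  rintro ⟨V, -, -, hV⟩
  have h1 : ∀ᵐ t ∂torusMeasure, blaschkeFactor α (coord t) • Q = Q * V := by
    filter_upwards [hV] with t ht
    rw [← ht, potapovFactor, Matrix.mul_add, Matrix.mul_sub, Matrix.mul_smul, hQQ, Matrix.mul_one,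
      sub_self, zero_add]
  have h2 : (0 : Matrix (Fin n) (Fin n) ℂ) = Q * V := by
    rw [← poissonIntegral_blaschkeFactor_smul hα (MemHInfty.const Q), poissonIntegral_congr h1,
      poissonIntegral_const hα]
  obtain ⟨t, ht⟩ := h1.exists
  rw [← h2] at ht
  exact smul_ne_zero (blaschkeFactor_coord_ne_zero hα t) hQ0 ht

/-- If `Q` annihilates `Φ(α)` then the corresponding Blaschke–Potapov factor divides `Φ`. -/
lemma isLeftInnerDivisor_potapovFactor (hα : ‖α‖ < 1) {Q : Matrix (Fin n) (Fin n) ℂ}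
    (hQ : Qᴴ = Q) (hQQ : Q * Q = Q) {Φ : Torus → Matrix (Fin n) (Fin m) ℂ} (hΦ : MemHInfty Φ)
    (h0 : Q * poissonIntegral Φ α = 0) : IsLeftInnerDivisor (potapovFactor α Q) Φ := by
  have hQΦ : poissonIntegral (fun t => Q * Φ t) α = 0 := by
    rw [poissonIntegral_mul hα (MemHInfty.const Q) hΦ, poissonIntegral_const hα, h0]
  have h1 : (1 - Q) * Q = 0 := by rw [Matrix.sub_mul, hQQ, Matrix.one_mul, sub_self]
  have h2 : Q * (1 - Q) = 0 := by rw [Matrix.mul_sub, hQQ, Matrix.mul_one, sub_self]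
  have h3 : (1 - Q) * (1 - Q) = 1 - Q := by
    rw [Matrix.mul_sub, h1, Matrix.mul_one, sub_zero]
  -- The quotient is `(1 - Q)Φ + b_α⁻¹ QΦ`, in `H^∞` because `QΦ` vanishes at `α`.
  refine ⟨isInner_potapovFactor hα hQ hQQ, _, ((MemHInfty.const (1 - Q)).mul hΦ).add
    (((MemHInfty.const Q).mul hΦ).div_blaschkeFactor hα hQΦ),
    Filter.Eventually.of_forall fun t => ?_⟩
  have hb := blaschkeFactor_coord_ne_zero hα t
  simp only [potapovFactor, Matrix.add_mul, Matrix.mul_add, Matrix.smul_mul, Matrix.mul_smul,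
    ← Matrix.mul_assoc, h1, h2, h3, hQQ, smul_smul, inv_mul_cancel₀ hb, smul_zero, one_smul,
    add_zero, zero_add]
  rw [← Matrix.add_mul, sub_add_cancel, Matrix.one_mul]

/-! ### Finite Blaschke products and the coprimeness criteria. -/

variable {θ : ℂ → ℂ}

lemma mem_zeros_of_eq {ν : ℂ} {M : ℕ} {a : Fin M → ℂ} (ha : ∀ j, ‖a j‖ < 1)
    (hθ : ∀ z : ℂ, ‖z‖ ≤ 1 → θ z = ν * ∏ j, blaschkeFactor (a j) z) (j : Fin M) :
    a j ∈ zeros θ := by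
  refine ⟨ha j, ?_⟩
  rw [hθ _ (ha j).le, Finset.prod_eq_zero (Finset.mem_univ j) (by simp [blaschkeFactor]), mul_zero]

lemma exists_eq_of_mem_zeros {ν : ℂ} (hν : ‖ν‖ = 1) {M : ℕ} {a : Fin M → ℂ} (ha : ∀ j, ‖a j‖ < 1)
    (hθ : ∀ z : ℂ, ‖z‖ ≤ 1 → θ z = ν * ∏ j, blaschkeFactor (a j) z) (hα : α ∈ zeros θ) :
    ∃ j, a j = α := by
  have hν0 : ν ≠ 0 := fun h0 => by simp [h0] at hν
  have h := hα.2
  rw [hθ α hα.1.le, mul_eq_zero, or_iff_right hν0, Finset.prod_eq_zero_iff] at h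
  obtain ⟨j, -, hj⟩ := h
  rw [blaschkeFactor, div_eq_zero_iff,
    or_iff_left (one_sub_conj_mul_ne_zero (ha j) hα.1.le), sub_eq_zero] at hj
  exact ⟨j, hj.symm⟩

lemma scalarFunction_eq {ν : ℂ} {M : ℕ} {a : Fin M → ℂ}
    (hθ : ∀ z : ℂ, ‖z‖ ≤ 1 → θ z = ν * ∏ j, blaschkeFactor (a j) z) (t : Torus) :
    scalarFunction n θ t =
      (ν * ∏ j, blaschkeFactor (a j) (coord t)) • (1 : Matrix (Fin n) (Fin n) ℂ) := by
  rw [← hθ _ (norm_coord t).le]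
  rfl

lemma memHInfty_scalarFunction (hθ : IsFiniteBlaschkeProduct θ) :
    MemHInfty (scalarFunction n θ) := by
  obtain ⟨ν, M, a, hν, ha, hθ⟩ := hθ
  rw [funext fun t => scalarFunction_eq (n := n) hθ t]
  exact MemHInfty.smul ((MemScalarHInfty.prod fun j _ =>
    memScalarHInfty_blaschkeFactor (ha j)).const_mul ν) (MemHInfty.const 1)

lemma poissonIntegral_scalarFunction_eq_zero (hθ : IsFiniteBlaschkeProduct θ)
    (hα : α ∈ zeros θ) : poissonIntegral (scalarFunction n θ) α = 0 := by
  obtain ⟨ν, M, a, hν, ha, hθ⟩ := hθ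
  obtain ⟨j, rfl⟩ := exists_eq_of_mem_zeros hν ha hθ hα
  have hm : MemScalarHInfty fun t =>
      ν * ∏ i ∈ Finset.univ.erase j, blaschkeFactor (a i) (coord t) :=
    (MemScalarHInfty.prod fun i _ => memScalarHInfty_blaschkeFactor (ha i)).const_mul ν
  rw [← poissonIntegral_blaschkeFactor_smul (ha j)
    (MemHInfty.smul hm (MemHInfty.const (1 : Matrix (Fin n) (Fin n) ℂ)))]
  congr 1
  ext t : 1
  rw [scalarFunction_eq hθ, smul_smul, mul_left_comm,
    Finset.mul_prod_erase _ (fun i => blaschkeFactor (a i) (coord t)) (Finset.mem_univ j)]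

/-- `Φ` and `θ I` are left coprime if and only if `Φ` is invertible at the zeros of `θ`. -/
theorem leftCoprime_scalarFunction_iff {Φ : Torus → Matrix (Fin n) (Fin n) ℂ} (hΦ : MemHInfty Φ)
    (hθ : IsFiniteBlaschkeProduct θ) :
    LeftCoprime Φ (scalarFunction n θ) ↔ ∀ α ∈ zeros θ, IsUnit (poissonIntegral Φ α) := by
  constructor
  · intro h α hα
    by_contra hu
    obtain ⟨Q, hQ, hQQ, hQ0, hQA⟩ := exists_projection_mul_eq_zero hu
    refine not_isUnitaryConstant_potapovFactor hα.1 hQQ hQ0 (h n _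
      (isLeftInnerDivisor_potapovFactor hα.1 hQ hQQ hΦ hQA)
      (isLeftInnerDivisor_potapovFactor hα.1 hQ hQQ (memHInfty_scalarFunction hθ) ?_))
    rw [poissonIntegral_scalarFunction_eq_zero hθ hα, Matrix.mul_zero]
  · obtain ⟨ν, M, a, hν, ha, hθ⟩ := hθ
    rintro h k Δ ⟨hΔ, A, hA, hΦA⟩ ⟨-, B, hB, hθB⟩
    have hν0 : ν ≠ 0 := fun h0 => by simp [h0] at hν
    have hθB' : ∀ᵐ t ∂torusMeasure, Δ t * B t =
        (ν * ∏ j, blaschkeFactor (a j) (coord t)) • (1 : Matrix (Fin n) (Fin n) ℂ) :=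
      hθB.mono fun t ht => by rw [← ht, scalarFunction_eq hθ]
    -- One point of the circle where both identities hold suffices to see that `Δ` is square.
    obtain ⟨t, ht, ht'⟩ := (hθB'.and hΔ.isometry).exists
    obtain rfl : k = n := eq_of_isometry_of_mul_eq_smul_one
      (mul_ne_zero hν0 (Finset.prod_ne_zero_iff.mpr fun j _ =>
        blaschkeFactor_coord_ne_zero (ha j) t)) ht' ht
    have hu (j : Fin M) : IsUnit (poissonIntegral Δ (a j)) := by
      have h1 := h (a j) (mem_zeros_of_eq ha hθ j)
      rw [poissonIntegral_congr hΦA, poissonIntegral_mul (ha j) hΔ.memHInfty hA,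
        Matrix.isUnit_iff_isUnit_det, Matrix.det_mul] at h1
      rw [Matrix.isUnit_iff_isUnit_det]
      exact isUnit_of_mul_isUnit_left h1
    obtain ⟨C, hC, hΔC⟩ := exists_mul_eq_of_mul_eq_blaschke hΔ.memHInfty ν a ha hu B hB hθB'
    exact isUnitaryConstant_of_mul_eq_const hΔ hC hν hΔC

lemma conj_blaschkeFactor_conj (α z : ℂ) :
    conj (blaschkeFactor α (conj z)) = blaschkeFactor (conj α) z := by
  simp [blaschkeFactor]

lemma IsFiniteBlaschkeProduct.conj_conj (hθ : IsFiniteBlaschkeProduct θ) :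
    IsFiniteBlaschkeProduct fun z => conj (θ (conj z)) := by
  obtain ⟨ν, M, a, hν, ha, hθ⟩ := hθ
  refine ⟨conj ν, M, fun j => conj (a j), by rwa [RCLike.norm_conj],
    fun j => by rw [RCLike.norm_conj]; exact ha j, fun z hz => ?_⟩
  beta_reduce
  rw [hθ _ (by rwa [RCLike.norm_conj]), map_mul, map_prod]
  simp only [conj_blaschkeFactor_conj]

lemma tilde_scalarFunction (n : ℕ) (θ : ℂ → ℂ) :
    tilde (scalarFunction n θ) = scalarFunction n fun z => conj (θ (conj z)) := by
  ext t : 1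
  change (θ (coord (-t)) • (1 : Matrix (Fin n) (Fin n) ℂ))ᴴ = conj (θ (conj (coord t))) • 1
  rw [Matrix.conjTranspose_smul, Matrix.conjTranspose_one, coord_neg]
  rfl

lemma mem_zeros_conj_conj : α ∈ zeros (fun z => conj (θ (conj z))) ↔ conj α ∈ zeros θ := by
  simp [zeros]

/-- `Φ` and `θ I` are right coprime if and only if `Φ` is invertible at the zeros of `θ`. -/
theorem rightCoprime_scalarFunction_iff {Φ : Torus → Matrix (Fin n) (Fin n) ℂ} (hΦ : MemHInfty Φ)
    (hθ : IsFiniteBlaschkeProduct θ) :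
    RightCoprime Φ (scalarFunction n θ) ↔ ∀ α ∈ zeros θ, IsUnit (poissonIntegral Φ α) := by
  rw [RightCoprime, tilde_scalarFunction, leftCoprime_scalarFunction_iff hΦ.tilde hθ.conj_conj]
  constructor
  · intro h α hα
    have h1 := h (conj α) (mem_zeros_conj_conj.mpr (by rwa [Complex.conj_conj]))
    rw [poissonIntegral_tilde hα.1] at h1
    simpa using h1.star
  · intro h α hα
    have h0 := mem_zeros_conj_conj.mp hα
    have h1 := (h _ h0).star
    rwa [Matrix.star_eq_conjTranspose, ← poissonIntegral_tilde h0.1, Complex.conj_conj] at h1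

end HInfty

theorem corollary4p6 (n : ℕ) (Φ : HInfty.Torus → Matrix (Fin n) (Fin n) ℂ)
    (hΦ : HInfty.MemHInfty Φ) (θ : ℂ → ℂ) (hθ : HInfty.IsFiniteBlaschkeProduct θ) :
    List.TFAE
      [∀ α ∈ HInfty.zeros θ, IsUnit (HInfty.poissonIntegral Φ α),
        HInfty.RightCoprime Φ (HInfty.scalarFunction n θ),
        HInfty.LeftCoprime Φ (HInfty.scalarFunction n θ)] := by
  tfae_have 2 ↔ 1 := HInfty.rightCoprime_scalarFunction_iff hΦ hθ
  tfae_have 3 ↔ 1 := HInfty.leftCoprime_scalarFunction_iff hΦ hθ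
  tfae_finish
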